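/- For a positive integer $n$, let $L_n$ be the $n\times n$ lower triangular $0$-$1$ matrix whose entries on and below the main diagonal are $1$ and whose other entries are $0$, and let $\mathcal{H}_n$ be the set of all matrices obtained from $L_n$ by an arbitrary row permutation and an arbitrary column permutation (equivalently, the bipartite adjacency matrices of half graphs with parts $[n]$ and $[n]$). A quantum query algorithm on inputs $x\in\{0,1\}^{I}$ ($I$ a finite set) with outputs in a finite set $R$ starts in a fixed unit vector of $\mathbb{C}^{I}\otimes\mathbb{C}^2\otimes\mathbb{C}^w$ for some $w$, applies $U_0,O_x,U_1,O_x,\dots,O_x,U_T$, where $U_0,\dots,U_T$ are unitaries and $O_x|i\rangle|b\rangle|z\rangle=|i\rangle|b+x_i \bmod 2\rangle|z\rangle$, and then performs a measurement (a POVM) with outcomes in $R$; the initial vector, the unitaries and the measurement do not depend on $x$. It makes $T$ queries. Let $\mathsf{Q}(\mathcal{H}_n)$ be the least $T$ for which some such algorithm with $I=[n]\times[n]$ and $R=\mathcal{H}_n$, given as input $x$ the entries of any $M\in\mathcal{H}_n$, outputs $M$ with probability at least $2/3$. Then $\mathsf{Q}(\mathcal{H}_n)=\Omega(n\log n)$: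 there is a constant $c>0$ such that $\mathsf{Q}(\mathcal{H}_n)\ge c\,n\log_2 n$ for every integer $n\ge 1$. -/

import Mathlib

noncomputable section

namespace HalfGraph

/-- The state space `ℂ^ι ⊗ ℂ² ⊗ ℂ^w` of a quantum query algorithm: its standard basis vectors are
`|i⟩|b⟩|z⟩` with `i` in the query register, `b` in the answer register and `z` in the workspace. -/
abbrev StateSpace (ι : Type) [Fintype ι] (w : ℕ) : Type :=
  EuclideanSpace ℂ (ι × Bool × Fin w)

/-- The permutation `(i, b, z) ↦ (i, b + x_i mod 2, z)` of the basis labels. -/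
def queryPerm {ι : Type} (w : ℕ) (x : ι → Bool) : Equiv.Perm (ι × Bool × Fin w) where
  toFun a := (a.1, xor a.2.1 (x a.1), a.2.2)
  invFun a := (a.1, xor a.2.1 (x a.1), a.2.2)
  left_inv a := by simp
  right_inv a := by simp

/-- The query operation `O_x : |i⟩|b⟩|z⟩ ↦ |i⟩|b + x_i mod 2⟩|z⟩`. -/
def queryOracle {ι : Type} [Fintype ι] (w : ℕ) (x : ι → Bool) :
    StateSpace ι w ≃ₗᵢ[ℂ] StateSpace ι w :=
  LinearIsometryEquiv.piLpCongrLeft 2 ℂ ℂ (queryPerm w x)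

/-- The action of `O_x` on the standard basis. -/
theorem queryOracle_single {ι : Type} [Fintype ι] [DecidableEq ι] (w : ℕ) (x : ι → Bool)
    (i : ι) (b : Bool) (z : Fin w) :
    queryOracle w x (EuclideanSpace.single (i, b, z) 1)
      = EuclideanSpace.single (i, xor b (x i), z) 1 := by
  simp [queryOracle, queryPerm]

/-- A quantum query algorithm with outputs in `R` on inputs `x ∈ {0,1}^ι`. It starts in the fixed
state `init`, applies `U 0, O_x, U 1, O_x, …, O_x, U T` with `T = numQueries` (the values of `U`
beyond `T` play no role) and performs a measurement with outcomes in `R`, given by the positive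
operators `effect r` that sum to the identity. Nothing but `O_x` depends on the input. -/
structure QuantumQueryAlgorithm (ι : Type) [Fintype ι] (R : Type) [Fintype R] where
  numQueries : ℕ
  workDim : ℕ
  init : StateSpace ι workDim
  norm_init : ‖init‖ = 1
  U : ℕ → (StateSpace ι workDim ≃ₗᵢ[ℂ] StateSpace ι workDim)
  effect : R → (StateSpace ι workDim →L[ℂ] StateSpace ι workDim)
  effect_isPositive : ∀ r, (effect r).IsPositive
  sum_effect : ∑ r, effect r = 1

namespace QuantumQueryAlgorithm

variable {ι : Type} [Fintype ι] {R : Type} [Fintype R]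

/-- The state after `t` queries, i.e. `U_t O_x U_{t-1} ⋯ O_x U_0 |init⟩`. -/
def state (A : QuantumQueryAlgorithm ι R) (x : ι → Bool) : ℕ → StateSpace ι A.workDim
  | 0 => A.U 0 A.init
  | t + 1 => A.U (t + 1) (queryOracle A.workDim x (A.state x t))

/-- The probability that `A` outputs `r` on input `x`. -/
def outputProb (A : QuantumQueryAlgorithm ι R) (x : ι → Bool) (r : R) : ℝ :=
  (inner ℂ (A.state x A.numQueries) (A.effect r (A.state x A.numQueries))).re

/-- `A` computes `f : D → R` with error at most `1/3`. -/
def Computes (A : QuantumQueryAlgorithm ι R) {D : Set (ι → Bool)} (f : D → R) : Prop :=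
  ∀ x : D, 2 / 3 ≤ A.outputProb x (f x)

end QuantumQueryAlgorithm

/-- The bounded-error quantum query complexity `Q(f)` of `f : D → R`, `D ⊆ {0,1}^ι`: the least
number of queries of a quantum query algorithm that computes `f` with error at most `1/3`. -/
def quantumQueryComplexity {ι : Type} [Fintype ι] {R : Type} [Fintype R]
    {D : Set (ι → Bool)} (f : D → R) : ℕ∞ :=
  ⨅ (A : QuantumQueryAlgorithm ι R) (_ : A.Computes f), (A.numQueries : ℕ∞)

/-- A 0-1 matrix of order `n`; `true` stands for 1. -/
abbrev BoolMatrix (n : ℕ) : Type := Matrix (Fin n) (Fin n) Bool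

/-- The inputs, i.e. the vectors in `{0,1}^{[n] × [n]}` that list the entries of a member of `G`. -/
def inputs {n : ℕ} (G : Set (BoolMatrix n)) : Set (Fin n × Fin n → Bool) :=
  {x | Matrix.of (fun i j => x (i, j)) ∈ G}

/-- The identity function of `G`, with its input read as a vector in `{0,1}^{[n] × [n]}`. -/
def learn {n : ℕ} (G : Set (BoolMatrix n)) (x : inputs G) : G :=
  ⟨Matrix.of (fun i j => x.1 (i, j)), x.2⟩

instance {n : ℕ} (G : Set (BoolMatrix n)) : Fintype G := Fintype.ofFinite G

/-- `Q(G)`: the quantum edge-query complexity of learning a hidden bipartite graph from the class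
with bipartite adjacency matrices `G`; a query to `(i, j)` reads the entry `(i, j)`. -/
def quantumEdgeQueryComplexity {n : ℕ} (G : Set (BoolMatrix n)) : ℕ∞ :=
  quantumQueryComplexity (learn G)

/-- The lower triangular matrix `L_n`, with 1s exactly on and below the main diagonal. -/
def lowerTriangular (n : ℕ) : BoolMatrix n :=
  Matrix.of fun i j => decide (j ≤ i)

/-- `H_n`: the matrices obtained from `L_n` by a row permutation and a column permutation. -/
def halfGraphs (n : ℕ) : Set (BoolMatrix n) :=
  {M | ∃ σ τ : Equiv.Perm (Fin n), M = (lowerTriangular n).submatrix σ τ}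

end HalfGraph

end

namespace HalfGraph

open Finset

/-! This is a weighted adversary argument. The hard inputs have ordered columns and rows permuted by
`σ`; for each ordered pair `(a, b)`, `σ` is compared with `swap a b * σ`, with weight `1 / |a - b|`.
Around each `σ` these weights total at least `n log n`, by harmonic sums (`log_le_sum_inv_dist`).

A query at `(i, j)` only asks whether `j ≤ σ i`, so it separates the pair only if the swap carries
`σ i` across the gap before `j`. Measured from that gap, the weights of such swaps form a row of the
Hilbert matrix `1 / (p + q + 1)`. That matrix is bounded, and the Schur test proves it
(`sum_range_hilbert_le`); its test vector supplies the asymmetric weights `θ` that `adversary_bound`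
takes. Each query thus achieves only constant progress per input, which forces order `n log n`
queries. -/

/-! ### Effect of one query, and the final measurement -/

/-- The squared norm of the part of `u` whose query register holds `i`. -/
noncomputable def queryMass {ι : Type} [Fintype ι] {w : ℕ} (u : StateSpace ι w) (i : ι) : ℝ :=
  ∑ p : Bool × Fin w, ‖u (i, p)‖ ^ 2

theorem sum_queryMass {ι : Type} [Fintype ι] {w : ℕ} (u : StateSpace ι w) :
    ∑ i, queryMass u i = ‖u‖ ^ 2 := by
  rw [EuclideanSpace.norm_sq_eq, Fintype.sum_prod_type]
  rfl

theorem queryMass_nonneg {ι : Type} [Fintype ι] {w : ℕ} (u : StateSpace ι w) (i : ι) :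
    0 ≤ queryMass u i :=
  Finset.sum_nonneg fun _ _ => by positivity

theorem queryOracle_apply {ι : Type} [Fintype ι] {w : ℕ} (x : ι → Bool) (u : StateSpace ι w)
    (i : ι) (b : Bool) (z : Fin w) :
    queryOracle w x u (i, b, z) = u (i, xor b (x i), z) := rfl

theorem mul_abs_re_conj_mul_le {w θ θ' : ℝ} (hθ : 0 ≤ θ) (hθ' : 0 ≤ θ')
    (h : w ^ 2 ≤ θ * θ') (p q : ℂ) :
    w * |(inner ℂ p q).re| ≤ (θ * ‖p‖ ^ 2 + θ' * ‖q‖ ^ 2) / 2 := by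
  have h1 : |(inner ℂ p q).re| ≤ ‖p‖ * ‖q‖ :=
    (Complex.abs_re_le_norm _).trans (norm_inner_le_norm p q)
  have h2 : w ≤ √θ * √θ' := by
    rw [← Real.sqrt_mul hθ]
    exact Real.le_sqrt_of_sq_le h
  have h3 : w * |(inner ℂ p q).re| ≤ (√θ * √θ') * (‖p‖ * ‖q‖) := by gcongr
  have h4 := sq_nonneg (√θ * ‖p‖ - √θ' * ‖q‖)
  have h5 := Real.sq_sqrt hθ
  have h6 := Real.sq_sqrt hθ'
  have h7 : (√θ * ‖p‖ - √θ' * ‖q‖) ^ 2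
      = θ * ‖p‖ ^ 2 + θ' * ‖q‖ ^ 2 - 2 * ((√θ * √θ') * (‖p‖ * ‖q‖)) := by
    rw [← h5, ← h6]; simp only [Real.sqrt_sq (Real.sqrt_nonneg _)]; ring
  linarith

/-- One query changes the inner product of two states only through the query positions at which
the two inputs differ. -/
theorem query_progress_le {ι : Type} [Fintype ι] {w : ℕ} (x y : ι → Bool) (u v : StateSpace ι w)
    {c : ℝ} {θ θ' : ι → ℝ} (hc : 0 ≤ c) (hθ : ∀ i, 0 ≤ θ i) (hθ' : ∀ i, 0 ≤ θ' i)
    (h : ∀ i, x i ≠ y i → c ^ 2 ≤ θ i * θ' i) :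
    c * ((inner ℂ u v).re - (inner ℂ (queryOracle w x u) (queryOracle w y v)).re) ≤
      ∑ i, if x i ≠ y i then θ i * queryMass u i + θ' i * queryMass v i else 0 := by
  simp only [PiLp.inner_apply, Complex.re_sum]
  rw [← Finset.sum_sub_distrib, Finset.mul_sum, Fintype.sum_prod_type]
  refine Finset.sum_le_sum fun i _ => ?_
  rw [← Finset.mul_sum, Finset.sum_sub_distrib, Fintype.sum_prod_type, Fintype.sum_prod_type]
  have shift : ∀ (g : Bool → ℝ) (b : Bool), ∑ a, g (xor a b) = ∑ a, g a := by
    intro g b; cases b <;> simp [add_comm]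
  by_cases hxy : x i = y i
  · rw [if_neg (not_not.mpr hxy)]
    simp only [queryOracle_apply, ← hxy]
    rw [shift (fun b => ∑ z, (inner ℂ (u (i, b, z)) (v (i, b, z))).re)]
    simp
  · rw [if_pos hxy]
    have key := fun p q => mul_abs_re_conj_mul_le (hθ i) (hθ' i) (h i hxy) p q
    have e1 : c * ∑ b, ∑ z, (inner ℂ (u (i, b, z)) (v (i, b, z))).re
        ≤ (θ i * queryMass u i + θ' i * queryMass v i) / 2 := by
      rw [queryMass, queryMass, Fintype.sum_prod_type, Fintype.sum_prod_type]
      simp only [Finset.mul_sum, ← Finset.sum_add_distrib, Finset.sum_div]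
      gcongr with b _ z _
      exact (mul_le_mul_of_nonneg_left (le_abs_self _) hc).trans (key _ _)
    have e2 : -(c * ∑ b, ∑ z, (inner ℂ (queryOracle w x u (i, b, z))
          (queryOracle w y v (i, b, z))).re)
        ≤ (θ i * queryMass u i + θ' i * queryMass v i) / 2 := by
      rw [queryMass, queryMass, Fintype.sum_prod_type, Fintype.sum_prod_type,
        ← shift (fun b => ∑ z, ‖u (i, b, z)‖ ^ 2) (x i),
        ← shift (fun b => ∑ z, ‖v (i, b, z)‖ ^ 2) (y i)]
      simp only [Finset.mul_sum, ← Finset.sum_add_distrib, Finset.sum_div,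
        ← Finset.sum_neg_distrib, queryOracle_apply]
      gcongr with b _ z _
      rw [← mul_neg]
      exact (mul_le_mul_of_nonneg_left (neg_le_abs _) hc).trans (key _ _)
    rw [mul_sub]
    linarith

/-- Expand the nonnegative form of `P` at `u - c • v`; the free `c` replaces the square root in
Cauchy-Schwarz. -/
theorem re_inner_le_of_isPositive {E : Type*} [NormedAddCommGroup E] [InnerProductSpace ℂ E]
    [CompleteSpace E] {P : E →L[ℂ] E} (hP : P.IsPositive) (c : ℝ) (u v : E) :
    2 * c * (inner ℂ u (P v)).re ≤ (inner ℂ u (P u)).re + c ^ 2 * (inner ℂ v (P v)).re := by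
  have h := hP.re_inner_nonneg_right (u - (c : ℂ) • v)
  have hs : (inner ℂ v (P u)).re = (inner ℂ u (P v)).re := by
    rw [← hP.isSymmetric.apply_clm v u, ← inner_conj_symm (P v) u, Complex.conj_re]
  simp only [map_sub, map_smul, inner_sub_left, inner_sub_right, inner_smul_left,
    inner_smul_right, Complex.conj_ofReal, RCLike.re_to_complex, Complex.sub_re,
    Complex.re_ofReal_mul] at h
  rw [hs] at h
  nlinarith

/-- Two unit vectors told apart by a measurement with error at most `1/3` are far from parallel. -/
theorem re_inner_le_of_distinguished {E : Type*} [NormedAddCommGroup E] [InnerProductSpace ℂ E]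
    [CompleteSpace E] {P : E →L[ℂ] E} (hP : P.IsPositive) (hP' : (1 - P).IsPositive) {u v : E}
    (hu : ‖u‖ = 1) (hv : ‖v‖ = 1) (hpu : 2 / 3 ≤ (inner ℂ u (P u)).re)
    (hpv : (inner ℂ v (P v)).re ≤ 1 / 3) :
    (inner ℂ u v).re ≤ 17 / 18 := by
  -- The optimal ratios at probabilities 2/3 and 1/3 are √2 and 1/√2. The reciprocal rational values
  -- 4/3 and 3/4 give 17/18 in place of 2√2/3.
  have h1 := re_inner_le_of_isPositive hP (4 / 3) u v
  have h2 := re_inner_le_of_isPositive hP' (3 / 4) u v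
  have hu' : (inner ℂ u u).re = 1 := by simp [inner_self_eq_norm_sq_to_K, hu]
  have hv' : (inner ℂ v v).re = 1 := by simp [inner_self_eq_norm_sq_to_K, hv]
  simp only [sub_apply, one_apply_eq_self, inner_sub_right,
    Complex.sub_re, hu', hv'] at h2
  linarith

/-! ### The weighted adversary bound -/

namespace QuantumQueryAlgorithm

variable {ι : Type} [Fintype ι] {R : Type} [Fintype R]

theorem norm_state (A : QuantumQueryAlgorithm ι R) (x : ι → Bool) (t : ℕ) :
    ‖A.state x t‖ = 1 := by
  induction t with
  | zero => simp [state, A.norm_init]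
  | succ t ih => simp [state, ih]

theorem one_sub_effect_eq [DecidableEq R] (A : QuantumQueryAlgorithm ι R) (r : R) :
    1 - A.effect r = ∑ r' ∈ univ.erase r, A.effect r' := by
  rw [← A.sum_effect, ← Finset.add_sum_erase univ A.effect (mem_univ r), add_sub_cancel_left]

theorem isPositive_sum_effect (A : QuantumQueryAlgorithm ι R) (s : Finset R) :
    (∑ r ∈ s, A.effect r).IsPositive := by
  classical
  induction s using Finset.induction_on with
  | empty => simp
  | insert r s hr ih => rw [Finset.sum_insert hr]; exact (A.effect_isPositive r).add ih

theorem re_inner_state_le [DecidableEq R] (A : QuantumQueryAlgorithm ι R) {x y : ι → Bool}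
    {r s : R} (hx : 2 / 3 ≤ A.outputProb x r) (hy : 2 / 3 ≤ A.outputProb y s) (hrs : s ≠ r) :
    (inner ℂ (A.state x A.numQueries) (A.state y A.numQueries)).re ≤ 17 / 18 := by
  refine re_inner_le_of_distinguished (A.effect_isPositive r)
    (by rw [one_sub_effect_eq]; exact A.isPositive_sum_effect _) (A.norm_state x _)
    (A.norm_state y _) hx ?_
  set v := A.state y A.numQueries with hv
  have h := (A.isPositive_sum_effect ((univ.erase r).erase s)).re_inner_nonneg_right v
  have hsum : 1 = A.effect r + (A.effect s + ∑ q ∈ (univ.erase r).erase s, A.effect q) := by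
    rw [Finset.add_sum_erase _ _ (by simp [hrs]), Finset.add_sum_erase _ _ (mem_univ r),
      A.sum_effect]
  have h1 : (inner ℂ v ((1 : StateSpace ι A.workDim →L[ℂ] StateSpace ι A.workDim) v)).re = 1 := by
    simp [inner_self_eq_norm_sq_to_K, hv, A.norm_state]
  rw [hsum] at h1
  simp only [add_apply, inner_add_right, Complex.add_re,
    RCLike.re_to_complex] at h h1
  have h2 : 2 / 3 ≤ (inner ℂ v (A.effect s v)).re := hy
  linarith

/-- The weighted adversary bound. Each input `X s` is paired, for every `k`, with `X (act k s)`. -/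
theorem adversary_bound [DecidableEq R] (A : QuantumQueryAlgorithm ι R) {S K : Type}
    [Fintype S] [Fintype K] (X : S → ι → Bool) (f : S → R)
    (hf : ∀ s, 2 / 3 ≤ A.outputProb (X s) (f s))
    (act : K → S → S) (hact : ∀ k, Function.Involutive (act k))
    (w : K → ℝ) (hw : ∀ k, 0 ≤ w k) (hne : ∀ k s, w k ≠ 0 → f (act k s) ≠ f s)
    (θ : K → S → ι → ℝ) (hθ : ∀ k s i, 0 ≤ θ k s i)
    (hθw : ∀ k s i, X s i ≠ X (act k s) i → w k ^ 2 ≤ θ k s i * θ k (act k s) i)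
    {C : ℝ} (hC : ∀ s i, ∑ k, (if X s i ≠ X (act k s) i then θ k s i else 0) ≤ C) :
    Fintype.card S * ∑ k, w k ≤ 36 * C * A.numQueries * Fintype.card S := by
  set W : ℕ → ℝ := fun t => ∑ s, ∑ k, w k *
    (inner ℂ (A.state (X s) t) (A.state (X (act k s)) t)).re with hW
  have h0 : W 0 = Fintype.card S * ∑ k, w k := by
    simp [hW, state, inner_self_eq_norm_sq_to_K, A.norm_init]
  -- At least 1/18 of the initial potential must be lost, at most `2 * C` per query and input: hence
  -- the 36.
  have hT : W A.numQueries ≤ 17 / 18 * (Fintype.card S * ∑ k, w k) := by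
    have : W A.numQueries ≤ ∑ s : S, ∑ k, w k * (17 / 18) := by
      refine Finset.sum_le_sum fun s _ => Finset.sum_le_sum fun k _ => ?_
      by_cases hk : w k = 0
      · simp [hk]
      · exact mul_le_mul_of_nonneg_left
          (A.re_inner_state_le (hf s) (hf (act k s)) (hne k s hk)) (hw k)
    refine this.trans_eq ?_
    rw [Finset.sum_const, ← Finset.sum_mul, nsmul_eq_mul, Finset.card_univ]
    ring
  have hstep : ∀ t, W t - W (t + 1) ≤ 2 * C * Fintype.card S := by
    intro t
    set g : K → S → ι → ℝ := fun k s i =>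
      if X s i ≠ X (act k s) i then θ k s i * queryMass (A.state (X s) t) i else 0 with hg
    have e1 : W t - W (t + 1) ≤ ∑ s, ∑ k, ∑ i, (g k s i + g k (act k s) i) := by
      rw [hW]
      simp only [← Finset.sum_sub_distrib, ← mul_sub]
      refine Finset.sum_le_sum fun s _ => Finset.sum_le_sum fun k _ => ?_
      have h := query_progress_le (X s) (X (act k s)) (A.state (X s) t)
        (A.state (X (act k s)) t) (hw k) (hθ k s) (hθ k (act k s)) (hθw k s)
      simp only [state, LinearIsometryEquiv.inner_map_map]
      refine h.trans_eq (Finset.sum_congr rfl fun i _ => ?_)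
      simp only [hg, hact k s]
      by_cases hi : X s i = X (act k s) i
      · simp [hi]
      · rw [if_pos hi, if_pos hi, if_pos (Ne.symm hi)]
    have e2 : ∑ s, ∑ k, ∑ i, (g k s i + g k (act k s) i) = 2 * ∑ s, ∑ i, ∑ k, g k s i := by
      -- Each `act k` is a bijection of the inputs, so the partner's share of the loss sums to the
      -- same total.
      have e3 : ∑ s, ∑ k, ∑ i, g k (act k s) i = ∑ s, ∑ k, ∑ i, g k s i := by
        rw [Finset.sum_comm, Finset.sum_comm (s := (univ : Finset S)) (t := (univ : Finset K))]
        refine Finset.sum_congr rfl fun k _ => ?_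
        exact Equiv.sum_comp (hact k).toPerm (fun s => ∑ i, g k s i)
      simp only [Finset.sum_add_distrib]
      rw [e3, ← two_mul]
      congr 1
      exact Finset.sum_congr rfl fun s _ => Finset.sum_comm
    have e4 : ∑ s, ∑ i, ∑ k, g k s i ≤ ∑ _s : S, C := by
      refine Finset.sum_le_sum fun s _ => ?_
      have : ∀ i, ∑ k, g k s i ≤ C * queryMass (A.state (X s) t) i := by
        intro i
        refine le_trans (le_of_eq ?_)
          (mul_le_mul_of_nonneg_right (hC s i) (queryMass_nonneg _ i))
        rw [Finset.sum_mul]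
        exact Finset.sum_congr rfl fun k _ => by simp only [hg, ite_mul, zero_mul]
      refine (Finset.sum_le_sum fun i _ => this i).trans_eq ?_
      rw [← Finset.mul_sum, sum_queryMass, A.norm_state]
      ring
    rw [Finset.sum_const, nsmul_eq_mul, Finset.card_univ] at e4
    linarith
  have hall : ∀ t : ℕ, W 0 - W t ≤ t * (2 * C * Fintype.card S) := by
    intro t
    induction t with
    | zero => simp
    | succ t ih => have := hstep t; push_cast; linarith
  have := hall A.numQueries
  rw [h0] at this
  linarith

end QuantumQueryAlgorithm

/-! ### The Schur test for the Hilbert matrix -/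

theorem sum_range_inv_sqrt_le (m : ℕ) : ∑ q ∈ range m, 1 / √((q : ℝ) + 1) ≤ 2 * √m := by
  induction m with
  | zero => simp
  | succ m ih =>
    rw [Finset.sum_range_succ]
    have ha : 0 < √((m : ℝ) + 1) := Real.sqrt_pos.mpr (by positivity)
    have h1 := Real.sq_sqrt (show (0 : ℝ) ≤ m + 1 by positivity)
    have h2 := Real.sq_sqrt (show (0 : ℝ) ≤ m by positivity)
    have : 1 / √((m : ℝ) + 1) ≤ 2 * √((m : ℝ) + 1) - 2 * √m := by
      rw [div_le_iff₀ ha]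
      nlinarith [sq_nonneg (√((m : ℝ) + 1) - √m)]
    push_cast
    linarith

/-- Row sums of the Hilbert matrix with the weights of the Schur test. -/
theorem sum_range_hilbert_le (p m : ℕ) :
    ∑ q ∈ range m, 1 / ((p + q + 1 : ℝ) * √((q : ℝ) + 1)) ≤ 4 / √((p : ℝ) + 1) := by
  have hp : 0 < √((p : ℝ) + 1) := Real.sqrt_pos.mpr (by positivity)
  have hp2 := Real.sq_sqrt (show (0 : ℝ) ≤ p + 1 by positivity)
  have hterm : ∀ q : ℕ, 0 ≤ 1 / ((p + q + 1 : ℝ) * √((q : ℝ) + 1)) := fun q => by positivity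
  -- For `q ≤ p`, the factor `1 / (p + q + 1)` is at most `1 / (p + 1)`.
  have hhead : ∑ q ∈ range (p + 1), 1 / ((p + q + 1 : ℝ) * √((q : ℝ) + 1))
      ≤ 2 / √((p : ℝ) + 1) := by
    calc _ ≤ ∑ q ∈ range (p + 1), 1 / ((p : ℝ) + 1) * (1 / √((q : ℝ) + 1)) := by
          refine Finset.sum_le_sum fun q _ => ?_
          rw [one_div_mul_one_div]
          gcongr
          linarith [(Nat.cast_nonneg q : (0 : ℝ) ≤ q)]
      _ ≤ 1 / ((p : ℝ) + 1) * (2 * √((p : ℝ) + 1)) := by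
          rw [← Finset.mul_sum]
          have := sum_range_inv_sqrt_le (p + 1)
          push_cast at this
          gcongr
      _ = 2 / √((p : ℝ) + 1) := by
          rw [← hp2, Real.sqrt_sq hp.le]; field_simp
  -- For `q > p`, a term is at most `(q + 1) ^ (-3/2)`, which telescopes against `2 / √(q + 1)`.
  have htail : ∀ r : ℕ, ∑ q ∈ range (p + 1 + r), 1 / ((p + q + 1 : ℝ) * √((q : ℝ) + 1))
      ≤ 4 / √((p : ℝ) + 1) - 2 / √((p + r : ℝ) + 1) := by
    intro r
    induction r with
    | zero =>
      simp only [add_zero, Nat.cast_zero]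
      refine hhead.trans (le_of_eq ?_)
      ring
    | succ r ih =>
      rw [← add_assoc, Finset.sum_range_succ]
      push_cast
      have ha : 0 < √((p + r : ℝ) + 1) := Real.sqrt_pos.mpr (by positivity)
      have hb : 0 < √((p + r : ℝ) + 1 + 1) := Real.sqrt_pos.mpr (by positivity)
      have ha2 := Real.sq_sqrt (show (0 : ℝ) ≤ p + r + 1 by positivity)
      have hb2 := Real.sq_sqrt (show (0 : ℝ) ≤ p + r + 1 + 1 by positivity)
      have hab : √((p + r : ℝ) + 1) ≤ √((p + r : ℝ) + 1 + 1) := Real.sqrt_le_sqrt (by linarith)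
      have key : 1 / ((p + (p + 1 + r) + 1 : ℝ) * √((p + 1 + r : ℝ) + 1))
          ≤ 2 / √((p + r : ℝ) + 1) - 2 / √((p + r : ℝ) + 1 + 1) := by
        have e : (p + 1 + r : ℝ) + 1 = p + r + 1 + 1 := by ring
        rw [e]
        set a := √((p + r : ℝ) + 1)
        set b := √((p + r : ℝ) + 1 + 1)
        calc _ ≤ 1 / (b ^ 2 * b) := by
              gcongr
              rw [hb2]
              linarith [(Nat.cast_nonneg p : (0 : ℝ) ≤ p)]
          _ ≤ 2 / a - 2 / b := by
              rw [div_sub_div _ _ ha.ne' hb.ne', div_le_div_iff₀ (by positivity) (by positivity)]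
              have h1 : (b - a) * (b + a) = 1 := by nlinarith
              have h2 : 1 ≤ (b - a) * (2 * b) := by
                have : (b - a) * (b + a) ≤ (b - a) * (2 * b) :=
                  mul_le_mul_of_nonneg_left (by linarith) (by linarith)
                linarith
              have h3 : a * b ≤ b ^ 2 := by nlinarith
              have h4 : b ^ 2 * 1 ≤ b ^ 2 * ((b - a) * (2 * b)) := by gcongr
              nlinarith
      have e2 : (p + (r + 1) + 1 : ℝ) = p + r + 1 + 1 := by ring
      rw [e2]
      linarith
  calc _ ≤ ∑ q ∈ range (p + 1 + m), 1 / ((p + q + 1 : ℝ) * √((q : ℝ) + 1)) :=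
        Finset.sum_le_sum_of_subset_of_nonneg (Finset.range_mono (by omega))
          fun q _ _ => hterm q
    _ ≤ _ := (htail m).trans (by simp only [sub_le_self_iff]; positivity)

/-! ### Load of a query and total weight -/

/-- The distance of `c` from the gap between `j - 1` and `j`, counted from `1`. -/
def gapDist (c j : ℕ) : ℕ := if c < j then j - c else c - j + 1

theorem gapDist_pos (c j : ℕ) : 0 < gapDist c j := by
  unfold gapDist; split_ifs <;> omega

/-- Across the gap, distances `p + 1` and `q + 1` give `|c - d| = p + q + 1`, and each `q` occurs
for at most one `d`. So this is part of a Hilbert row, rescaled by `√(p + 1)`. -/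
theorem sum_separated_le {n : ℕ} (c j : Fin n) :
    ∑ d : Fin n, (if decide (j ≤ c) ≠ decide (j ≤ d) then
      1 / |(c : ℝ) - d| * √((gapDist c j : ℝ) / gapDist d j) else 0) ≤ 4 := by
  classical
  obtain ⟨p, hp⟩ : ∃ p, gapDist c j = p + 1 := ⟨gapDist c j - 1, by have := gapDist_pos c j; omega⟩
  set F : ℕ → ℝ := fun q => 1 / ((p + q + 1 : ℝ) * √((q : ℝ) + 1)) with hF
  have hterm : ∀ d ∈ univ.filter (fun d : Fin n => decide (j ≤ c) ≠ decide (j ≤ d)),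
      1 / |(c : ℝ) - d| * √((gapDist c j : ℝ) / gapDist d j)
        = √((p : ℝ) + 1) * F (gapDist d j - 1) := by
    intro d hd
    obtain ⟨q, hq⟩ : ∃ q, gapDist d j = q + 1 :=
      ⟨gapDist d j - 1, by have := gapDist_pos d j; omega⟩
    have habs : |(c : ℝ) - d| = p + q + 1 := by
      simp only [mem_filter, mem_univ, true_and, ne_eq, decide_eq_decide, Fin.le_def] at hd
      unfold gapDist at hp hq
      by_cases h : (c : ℕ) < j
      · have h' : ¬ (d : ℕ) < j := by omega
        rw [if_pos h] at hp
        rw [if_neg h'] at hq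
        have : (d : ℕ) = c + (p + q + 1) := by omega
        rw [this]
        push_cast
        rw [abs_sub_comm, add_sub_cancel_left, abs_of_nonneg (by positivity)]
      · have h' : (d : ℕ) < j := by omega
        rw [if_neg h] at hp
        rw [if_pos h'] at hq
        have : (c : ℕ) = d + (p + q + 1) := by omega
        rw [this]
        push_cast
        rw [add_sub_cancel_left, abs_of_nonneg (by positivity)]
    rw [habs, hp, hq, hF, Real.sqrt_div (by positivity)]
    push_cast [Nat.add_sub_cancel]
    field_simp
  have hinj : Set.InjOn (fun d : Fin n => gapDist d j - 1)
      (univ.filter (fun d : Fin n => decide (j ≤ c) ≠ decide (j ≤ d)) : Finset (Fin n)) := by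
    intro d hd d' hd' h
    simp only [coe_filter, mem_univ, true_and, Set.mem_ofPred_eq, ne_eq, decide_eq_decide,
      Fin.le_def] at hd hd'
    unfold gapDist at h
    ext
    by_cases h1 : (d : ℕ) < j
    · have h2 : (d' : ℕ) < j := by omega
      simp only [h1, h2, if_true] at h
      omega
    · have h2 : ¬ (d' : ℕ) < j := by omega
      simp only [h1, h2, if_false] at h
      omega
  rw [← Finset.sum_filter, Finset.sum_congr rfl hterm, ← Finset.mul_sum,
    ← Finset.sum_image (f := F) hinj]
  have hsub : (univ.filter (fun d : Fin n => decide (j ≤ c) ≠ decide (j ≤ d))).image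
      (fun d : Fin n => gapDist d j - 1) ⊆ range n := by
    intro q hq
    simp only [mem_image] at hq
    obtain ⟨d, -, rfl⟩ := hq
    rw [mem_range]
    unfold gapDist
    split_ifs <;> omega
  have hle := (Finset.sum_le_sum_of_subset_of_nonneg hsub
    (fun q _ _ => (by positivity : 0 ≤ F q))).trans (sum_range_hilbert_le p n)
  have hpos : 0 < √((p : ℝ) + 1) := Real.sqrt_pos.mpr (by positivity)
  rw [le_div_iff₀ hpos] at hle
  linarith

/-- The two sides of `a` give harmonic sums of lengths `a` and `m = n - 1 - a`, and `(a + 1) * (m +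
1) ≥ n`. The term `b = a` is `1 / 0 = 0`. -/
theorem log_le_sum_inv_dist {n : ℕ} (a : Fin n) :
    Real.log n ≤ ∑ b : Fin n, 1 / |(a : ℝ) - b| := by
  have hharm : ∀ m : ℕ, Real.log (m + 1) ≤ ∑ d ∈ range m, 1 / ((d : ℝ) + 1) := by
    intro m
    have := log_add_one_le_harmonic m
    simpa [harmonic] using this
  obtain ⟨m, hm⟩ : ∃ m, n = a + 1 + m := ⟨n - (a + 1), by omega⟩
  have h2 : ∑ b : Fin n, 1 / |(a : ℝ) - b|
      = ∑ d ∈ range a, 1 / ((d : ℝ) + 1) + ∑ d ∈ range m, 1 / ((d : ℝ) + 1) := by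
    rw [Fin.sum_univ_eq_sum_range (fun b => 1 / |((a : ℕ) : ℝ) - b|) n]
    rw [show range n = range (a + 1 + m) by rw [← hm], Finset.sum_range_add, Finset.sum_range_succ, ← Finset.sum_range_reflect]
    simp only [sub_self, abs_zero, div_zero, add_zero]
    congr 1
    · refine Finset.sum_congr rfl fun d hd => ?_
      have hd' := mem_range.mp hd
      have : ((a : ℕ) : ℝ) = ((a : ℕ) - 1 - d : ℕ) + (d + 1) := by
        have : (a : ℕ) = ((a : ℕ) - 1 - d : ℕ) + (d + 1) := by omega
        exact_mod_cast this
      rw [show ((a : ℕ) : ℝ) - ((a : ℕ) - 1 - d : ℕ) = d + 1 by linarith,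
        abs_of_nonneg (by positivity)]
    · refine Finset.sum_congr rfl fun d _ => ?_
      push_cast
      rw [abs_sub_comm, show ((a : ℕ) : ℝ) + 1 + d - (a : ℕ) = d + 1 by ring,
        abs_of_nonneg (by positivity)]
  rw [h2]
  refine le_trans ?_ (add_le_add (hharm a) (hharm m))
  rw [← Real.log_mul (by positivity) (by positivity)]
  have hn : (n : ℝ) = a + 1 + m := by exact_mod_cast hm
  rw [hn]
  refine Real.log_le_log (by positivity) ?_
  have : (0 : ℝ) ≤ (a : ℕ) * (m : ℝ) := by positivity
  nlinarith

/-! ### The adversary bound for half graphs -/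

/-- The entries of the half graph with permuted rows and ordered columns. -/
def rowPermInput {n : ℕ} (σ : Equiv.Perm (Fin n)) (e : Fin n × Fin n) : Bool :=
  decide (e.2 ≤ σ e.1)

theorem rowPermInput_mem {n : ℕ} (σ : Equiv.Perm (Fin n)) :
    rowPermInput σ ∈ inputs (halfGraphs n) :=
  ⟨σ, 1, rfl⟩

theorem rowPermInput_injective {n : ℕ} :
    Function.Injective (rowPermInput : Equiv.Perm (Fin n) → Fin n × Fin n → Bool) := by
  intro σ τ h
  ext i
  have h' : ∀ j, j ≤ σ i ↔ j ≤ τ i := fun j => by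
    simpa [rowPermInput] using congrFun h (i, j)
  exact congrArg Fin.val (le_antisymm ((h' _).mp le_rfl) ((h' _).mpr le_rfl))

theorem learn_eq_iff {n : ℕ} {G : Set (BoolMatrix n)} {x y : inputs G} :
    learn G x = learn G y ↔ x = y := by
  refine ⟨fun h => Subtype.ext (funext fun e => ?_), fun h => h ▸ rfl⟩
  exact congrFun (congrFun (congrArg Subtype.val h) e.1) e.2

/-- Only swaps that move `c` contribute, and `c` may be either entry of the ordered pair: twice the
bound 4. -/
theorem sum_swap_weight_le {n : ℕ} (c j : Fin n) :
    ∑ k : Fin n × Fin n, (if decide (j ≤ c) ≠ decide (j ≤ Equiv.swap k.1 k.2 c) then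
      1 / |(k.1 : ℝ) - k.2| * √((gapDist c j : ℝ) / gapDist (Equiv.swap k.1 k.2 c) j) else 0)
      ≤ 8 := by
  set h : Fin n → ℝ := fun d => if decide (j ≤ c) ≠ decide (j ≤ d) then
      1 / |(c : ℝ) - d| * √((gapDist c j : ℝ) / gapDist d j) else 0 with hh
  have hpos : ∀ d, 0 ≤ h d := fun d => by
    simp only [hh]; split_ifs <;> positivity
  have hbound : ∀ k : Fin n × Fin n,
      (if decide (j ≤ c) ≠ decide (j ≤ Equiv.swap k.1 k.2 c) then
      1 / |(k.1 : ℝ) - k.2| * √((gapDist c j : ℝ) / gapDist (Equiv.swap k.1 k.2 c) j) else 0)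
      ≤ (if k.1 = c then h k.2 else 0) + (if k.2 = c then h k.1 else 0) := by
    rintro ⟨a, b⟩
    dsimp only
    have hr : 0 ≤ (if a = c then h b else 0) + (if b = c then h a else 0) := by
      have := hpos a; have := hpos b
      split_ifs <;> positivity
    by_cases ha : a = c
    · subst ha
      rw [Equiv.swap_apply_left, if_pos rfl]
      refine le_add_of_le_of_nonneg le_rfl ?_
      have := hpos a
      split_ifs <;> simp [*]
    · by_cases hb : b = c
      · subst hb
        rw [Equiv.swap_apply_right, if_neg ha, if_pos rfl, zero_add, abs_sub_comm]
      · rw [Equiv.swap_apply_of_ne_of_ne (Ne.symm ha) (Ne.symm hb)]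
        simpa using hr
  refine (Finset.sum_le_sum fun k _ => hbound k).trans ?_
  have e := sum_separated_le c j
  rw [Finset.sum_add_distrib, Fintype.sum_prod_type, Fintype.sum_prod_type_right]
  simp only [Finset.sum_ite_eq',
    Finset.sum_comm (f := fun x y : Fin n => if x = c then h y else 0), mem_univ, if_true]
  linarith

theorem log_le_numQueries {n : ℕ}
    (A : QuantumQueryAlgorithm (Fin n × Fin n) (halfGraphs n))
    (hA : A.Computes (learn (halfGraphs n))) :
    n * Real.log n ≤ 288 * A.numQueries := by
  classical
  have hadv := A.adversary_bound (S := Equiv.Perm (Fin n)) (K := Fin n × Fin n)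
    rowPermInput (fun σ => learn (halfGraphs n) ⟨rowPermInput σ, rowPermInput_mem σ⟩)
    (fun σ => hA ⟨rowPermInput σ, rowPermInput_mem σ⟩)
    (fun k σ => Equiv.swap k.1 k.2 * σ)
    (fun k σ => by simp [← mul_assoc])
    -- Trivial swaps, with `k.1 = k.2`, get weight `1 / 0 = 0`.
    (fun k => 1 / |(k.1 : ℝ) - k.2|) (fun k => by positivity)
    (fun k σ hk h => by
      have h1 := rowPermInput_injective (congrArg Subtype.val (learn_eq_iff.mp h))
      rw [mul_eq_right, Equiv.swap_eq_one_iff] at h1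
      simp [h1] at hk)
    -- The ratio under the root inverts when the two inputs exchange roles, so the product is the
    -- squared weight.
    (fun k σ e => 1 / |(k.1 : ℝ) - k.2| *
      √((gapDist (σ e.1) e.2 : ℝ) / gapDist (Equiv.swap k.1 k.2 (σ e.1)) e.2))
    (fun k σ e => by positivity)
    (fun k σ e _ => by
      simp only [Equiv.Perm.mul_apply, Equiv.swap_apply_self]
      have h1 : (0 : ℝ) < gapDist (σ e.1) e.2 := by exact_mod_cast gapDist_pos _ _
      have h2 : (0 : ℝ) < gapDist (Equiv.swap k.1 k.2 (σ e.1)) e.2 := by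
        exact_mod_cast gapDist_pos _ _
      rw [mul_mul_mul_comm, ← Real.sqrt_mul (by positivity), div_mul_div_cancel₀ h2.ne',
        div_self h1.ne', Real.sqrt_one, mul_one, sq])
    (C := 8)
    (fun σ e => sum_swap_weight_le (σ e.1) e.2)
  have hcard : (0 : ℝ) < Fintype.card (Equiv.Perm (Fin n)) := by
    exact_mod_cast Fintype.card_pos
  rw [mul_comm] at hadv
  have h1 := le_of_mul_le_mul_right hadv hcard
  have h2 : n * Real.log n ≤ ∑ k : Fin n × Fin n, 1 / |(k.1 : ℝ) - k.2| := by
    rw [Fintype.sum_prod_type]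
    refine le_trans (le_of_eq ?_)
      (Finset.sum_le_sum fun a (_ : a ∈ univ) => log_le_sum_inv_dist a)
    simp
  linarith

end HalfGraph

theorem mainTheorem4 :
    ∃ c : ℝ, 0 < c ∧ ∀ n : ℕ, 1 ≤ n →
      ENNReal.ofReal (c * (n * Real.logb 2 n)) ≤
        (HalfGraph.quantumEdgeQueryComplexity (HalfGraph.halfGraphs n) : ENNReal) := by
  refine ⟨Real.log 2 / 288, by positivity, fun n _ => ?_⟩
  set r := Real.log 2 / 288 * (n * Real.logb 2 n) with hr
  have hr' : 288 * r = n * Real.log n := by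
    have : Real.log 2 ≠ 0 := (Real.log_pos one_lt_two).ne'
    rw [hr, Real.logb]
    field_simp
  -- Query counts are integers, so rounding `r` up lets the comparison take place in `ℕ∞`.
  have hle : ((⌈r⌉₊ : ℕ) : ℕ∞) ≤
      HalfGraph.quantumEdgeQueryComplexity (HalfGraph.halfGraphs n) := by
    refine le_iInf₂ fun A hA => ?_
    have := HalfGraph.log_le_numQueries A hA
    exact_mod_cast Nat.ceil_le.mpr (by linarith : r ≤ A.numQueries)
  calc ENNReal.ofReal r ≤ ENNReal.ofReal (⌈r⌉₊ : ℝ) :=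
        ENNReal.ofReal_le_ofReal (Nat.le_ceil r)
    _ = (((⌈r⌉₊ : ℕ) : ℕ∞) : ENNReal) := by simp
    _ ≤ _ := by exact_mod_cast hle
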